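/- A \emph{stem extension} of a finite group $G$ is a group $E$ with a surjective homomorphism $\pi:E\to G$ such that $\ker\pi\subseteq Z(E)\cap[E,E]$. The orders of the stem extensions of $G$ are bounded, and a stem extension of maximal order is called a \emph{Schur cover} of $G$. Given a Schur cover $\pi:\tilde G\to G$, the \emph{deep commuting graph} $\Delta_D(G)$ is the simple graph with vertex set $G$ in which two distinct elements $x,y$ are adjacent if and only if their preimages under $\pi$ commute in $\tilde G$. For a graph $\Gamma$, the \emph{reduced graph} $\Gamma^*$ is the subgraph induced on the set of those vertices that are not dominant, where a vertex is dominant if it is adjacent to every other vertex. Let $n\ge 8$ be an integer and let $A_n$ be the alternating group of degree $n$. For every choice of the Schur cover of $A_n$, the following hold. The graph $\Delta_D(A_n)^*$ is connected if and only if none of $n$, $n-1$, $n-2$ is prime. Moreover: (i) if, among $n,n-1,n-2$, only $n$ is prime, then $\Delta_D(A_n)^*$ has exactly $(n-2)!+1$ connected components; (ii) if only $n-1$ is prime, then $\Delta_D(A_n)^*$ has exactly $n\,(n-3)!+1$ connected components; (iii) if only $n-2$ is prime, then $\Delta_D(A_n)^*$ has exactly $\frac{n(n-1)(n-4)!}{2}+1$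 connected components; (iv) if both $n$ and $n-2$ are prime, then $\Delta_D(A_n)^*$ has exactly $(n-2)!+\frac{n(n-1)(n-4)!}{2}+1$ connected components. -/

import Mathlib

universe u v

/-- `π : E →* G` exhibits `E` as a stem extension of `G`: `π` is onto and its kernel lies in
`Z(E) ∩ [E, E]`. -/
structure IsStemExtension {G : Type u} {E : Type v} [Group G] [Group E] (π : E →* G) : Prop where
  surjective : Function.Surjective π
  ker_le_center : π.ker ≤ Subgroup.center E
  ker_le_commutator : π.ker ≤ commutator E

/-- `π : E →* G` exhibits `E` as a Schur cover of the finite group `G`: a finite stem extension of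
`G` whose order is maximal among all stem extensions of `G`. -/
structure IsSchurCover {G : Type u} {E : Type v} [Group G] [Group E] (π : E →* G) : Prop where
  finite : Finite E
  isStem : IsStemExtension π
  card_le : ∀ (H : Type v) [Group H] [Finite H] (ρ : H →* G),
    IsStemExtension ρ → Nat.card H ≤ Nat.card E

/-- The deep commuting graph of `G`, computed in the extension `π : E →* G`: distinct `x`, `y` are
adjacent iff their preimages under `π` commute in `E`. It is used for Schur covers `π`. -/
def deepCommutingGraph {G : Type u} {E : Type v} [Group G] [Group E] (π : E →* G) :
    SimpleGraph G where
  Adj x y := x ≠ y ∧ ∀ a b : E, π a = x → π b = y → Commute a b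
  symm := ⟨fun _ _ h => ⟨h.1.symm, fun a b ha hb => (h.2 b a hb ha).symm⟩⟩
  loopless := ⟨fun _ h => h.1 rfl⟩

/-- The reduced graph: the subgraph induced on the vertices that are not dominant (a vertex is
dominant if it is adjacent to every other vertex). -/
def reducedGraph {V : Type u} (Γ : SimpleGraph V) :
    SimpleGraph ((Γ.universalVerts)ᶜ : Set V) :=
  Γ.induce (Γ.universalVerts)ᶜ

/-- The orders of the finite stem extensions of a finite group are bounded. -/
theorem IsStemExtension.card_bound {G : Type u} {E : Type v} [Group G] [Finite G] [Group E]
    [Finite E] {π : E →* G} (h : IsStemExtension π) :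
    Nat.card E ≤ Nat.card G ^ (Nat.card G * Nat.card G ^ 2 + 1) * Nat.card G := by
  have hG : 0 < Nat.card G := Nat.card_pos
  have hidx : (Subgroup.center E).index ≤ Nat.card G := by
    have h1 : (Subgroup.center E).index ≤ π.ker.index :=
      Nat.le_of_dvd (Nat.pos_of_ne_zero Subgroup.index_ne_zero_of_finite)
        (Subgroup.index_dvd_of_le h.ker_le_center)
    rw [Subgroup.index_ker, MonoidHom.range_eq_top.2 h.surjective] at h1
    simpa using h1
  have hset : Nat.card (commutatorSet E) ≤ Nat.card G ^ 2 := by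
    let s := Function.surjInv h.surjective
    have hs : ∀ x, π (s x) = x := Function.surjInv_eq h.surjective
    have hc : ∀ x : E, ∃ z ∈ Subgroup.center E, x = s (π x) * z := fun x =>
      ⟨(s (π x))⁻¹ * x, h.ker_le_center (by simp [MonoidHom.mem_ker, hs]), by simp⟩
    have hsurj : Function.Surjective (fun p : G × G =>
        (⟨s p.1 * s p.2 * (s p.1)⁻¹ * (s p.2)⁻¹, s p.1, s p.2, rfl⟩ : commutatorSet E)) := by
      rintro ⟨_, x, y, rfl⟩
      refine ⟨(π x, π y), Subtype.ext ?_⟩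
      obtain ⟨z, hz, hxz⟩ := hc x
      obtain ⟨w, hw, hyw⟩ := hc y
      rw [Subgroup.mem_center_iff] at hz hw
      change s (π x) * s (π y) * (s (π x))⁻¹ * (s (π y))⁻¹ = x * y * x⁻¹ * y⁻¹
      generalize s (π x) = a at *
      generalize s (π y) = b at *
      subst hxz hyw
      simp only [mul_inv_rev]
      have e1 : a * z * (b * w) = a * b * (w * z) := by
        rw [mul_assoc a z, ← hz (b * w)]; group
      have e2 : z⁻¹ * a⁻¹ * (w⁻¹ * b⁻¹) = (w * z)⁻¹ * (a⁻¹ * b⁻¹) := by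
        have h3 : z⁻¹ * a⁻¹ * w⁻¹ = w⁻¹ * (z⁻¹ * a⁻¹) := by
          have := congrArg (·⁻¹) (hw (a * z))
          simp only [mul_inv_rev] at this
          rw [this]
        have h4 : w⁻¹ * z⁻¹ = z⁻¹ * w⁻¹ := by
          have := congrArg (·⁻¹) (hw z)
          simp only [mul_inv_rev] at this
          exact this
        rw [← mul_assoc, h3, mul_inv_rev, ← h4]; group
      calc a * b * a⁻¹ * b⁻¹ = a * b * (w * z) * ((w * z)⁻¹ * (a⁻¹ * b⁻¹)) := by group
        _ = a * z * (b * w) * (z⁻¹ * a⁻¹ * (w⁻¹ * b⁻¹)) := by rw [e1, e2]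
        _ = _ := by group
    have := Nat.card_le_card_of_surjective _ hsurj
    rwa [Nat.card_prod, ← sq] at this
  have hcomm : Nat.card (commutator E) ≤ Nat.card G ^ (Nat.card G * Nat.card G ^ 2 + 1) := by
    have hi : 0 < (Subgroup.center E).index := Nat.pos_of_ne_zero Subgroup.index_ne_zero_of_finite
    refine (Nat.le_of_dvd (Nat.pow_pos hi) (Subgroup.card_commutator_dvd_index_center_pow E)).trans ?_
    exact (Nat.pow_le_pow_left hidx _).trans (Nat.pow_le_pow_right hG
      (Nat.add_le_add_right (Nat.mul_le_mul hidx hset) 1))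
  have hker : Nat.card π.ker ≤ Nat.card (commutator E) :=
    Nat.card_le_card_of_injective _ (Subgroup.inclusion_injective h.ker_le_commutator)
  have hprod : Nat.card π.ker * Nat.card G = Nat.card E := by
    rw [← Subgroup.card_mul_index π.ker, Subgroup.index_ker,
      MonoidHom.range_eq_top.2 h.surjective]
    simp
  rw [← hprod]
  exact Nat.mul_le_mul_right _ (hker.trans hcomm)

/-- Every finite group has a Schur cover. -/
theorem exists_isSchurCover (G : Type u) [Group G] [Finite G] :
    ∃ (E : Type v) (_ : Group E) (π : E →* G), IsSchurCover π := by
  classical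
  let P : ℕ → Prop := fun m => ∃ (E : Type v) (_ : Group E) (_ : Finite E) (π : E →* G),
    IsStemExtension π ∧ Nat.card E = m
  have hbd : ∃ B, ∀ m, P m → m ≤ B := ⟨_, by
    rintro m ⟨E, _, _, π, h, rfl⟩
    exact h.card_bound⟩
  have hne : ∃ m, P m := by
    let f : Shrink.{v} G →* G := (Shrink.mulEquiv.{v} (α := G)).toMonoidHom
    have hk : f.ker = ⊥ := (MonoidHom.ker_eq_bot_iff f).2 (Shrink.mulEquiv.{v} (α := G)).injective
    exact ⟨_, Shrink.{v} G, inferInstance, inferInstance, f,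
      ⟨(Shrink.mulEquiv.{v} (α := G)).surjective, hk ▸ bot_le, hk ▸ bot_le⟩, rfl⟩
  obtain ⟨B, hB⟩ := hbd
  obtain ⟨m₀, hm₀⟩ := hne
  obtain ⟨E, i, hf, π, hπ, hE⟩ : P (Nat.findGreatest P B) :=
    Nat.findGreatest_spec (hB _ hm₀) hm₀
  exact ⟨E, i, π, hf, hπ, fun H _ _ ρ hρ => hE ▸
    Nat.le_findGreatest (hB _ ⟨H, _, ‹_›, ρ, hρ, rfl⟩) ⟨H, _, ‹_›, ρ, hρ, rfl⟩⟩

/-!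
In a central extension of the alternating group, the commutator `c` of lifts of two commuting
elements `x` and `y` is central and does not depend on the lifts, and its order divides the orders
of `x` and `y`. If moreover an even permutation commutes with `y` and conjugates `x` to `x ^ k`,
then `c = c ^ k`. A cycle of odd length is conjugate to its square and to its fourth power inside
its own support, so an even cycle `x` commutes deeply with every disjoint even permutation `y` as
soon as two points are left over or the length of `x` is prime to `3`.

Hence every non-trivial even permutation is linked first to a power of prime order, then (if that
order is odd) to one of its cycles, and finally to a three-cycle, unless it is a cycle of prime
length with at most two fixed points. All three-cycles are linked, and they form the main component.
An exceptional cycle commutes only with its own powers among the even permutations, so each other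
component consists of the generators of a subgroup generated by such a cycle. There are
`n! / (p * (n - p)!)` cycles of length `p`, hence `(p - 2)! * n.choose p` subgroups for each `p`.
-/

theorem commute_mul_conj_of_sq_eq_one {G : Type*} [Group G] {x t : G} (hx : x ^ 2 = 1)
    (h : Commute t (x * t * x⁻¹)) : Commute x (t * (x * t * x⁻¹)) := by
  have hconj : x * (x * t * x⁻¹) * x⁻¹ = t := calc
    x * (x * t * x⁻¹) * x⁻¹ = x ^ 2 * t * (x ^ 2)⁻¹ := by
      rw [sq, mul_inv_rev]
      simp only [mul_assoc]
    _ = t := by rw [hx, one_mul, inv_one, mul_one]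
  exact mul_inv_eq_iff_eq_mul.1 (by rw [← conj_mul, hconj, h.eq])

section CentralExtension

open Subgroup
open scoped commutatorElement

variable {G : Type u} {E : Type v} [Group G] [Group E] {π : E →* G}

/-- `π : E →* G` exhibits `E` as a central extension of `G`, the setting in which whether lifts of
two elements of `G` commute does not depend on the lifts. -/
structure IsCentralExtension (π : E →* G) : Prop where
  surjective : Function.Surjective π
  ker_le_center : π.ker ≤ center E

theorem IsStemExtension.isCentralExtension (hπ : IsStemExtension π) : IsCentralExtension π :=
  ⟨hπ.surjective, hπ.ker_le_center⟩

theorem commutatorElement_zpow_left_of_mem_center {a b : E} (h : ⁅a, b⁆ ∈ center E) (k : ℤ) :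
    ⁅a ^ k, b⁆ = ⁅a, b⁆ ^ k := by
  have hcomm : Commute ⁅a, b⁆ (b * a * b⁻¹) := (mem_center_iff.1 h _).symm
  have hzpow : a ^ k = ⁅a, b⁆ ^ k * (b * a ^ k * b⁻¹) := by
    rw [← conj_zpow, ← hcomm.mul_zpow]
    congr 1
    group
  calc ⁅a ^ k, b⁆ = a ^ k * (b * a ^ k * b⁻¹)⁻¹ := by group
    _ = ⁅a, b⁆ ^ k := mul_inv_eq_of_eq_mul hzpow

theorem exists_mem_center_eq_mul_of_map_eq (hz : π.ker ≤ center E) {a a' : E} (h : π a' = π a) :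
    ∃ z ∈ center E, a' = a * z :=
  ⟨a⁻¹ * a', hz (by simp [MonoidHom.mem_ker, h]), by simp⟩

theorem commute_of_map_eq (hz : π.ker ≤ center E) {a b a' b' : E} (ha : π a' = π a)
    (hb : π b' = π b) (h : Commute a b) : Commute a' b' := by
  obtain ⟨z, hz', rfl⟩ := exists_mem_center_eq_mul_of_map_eq hz ha
  obtain ⟨w, hw, rfl⟩ := exists_mem_center_eq_mul_of_map_eq hz hb
  exact (h.mul_right (mem_center_iff.1 hw a)).mul_left (mem_center_iff.1 hz' _).symm

theorem commutatorElement_eq_of_map_eq (hz : π.ker ≤ center E) {a b a' b' : E} (ha : π a' = π a)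
    (hb : π b' = π b) : ⁅a', b'⁆ = ⁅a, b⁆ := by
  obtain ⟨z, hz', rfl⟩ := exists_mem_center_eq_mul_of_map_eq hz ha
  obtain ⟨w, hw, rfl⟩ := exists_mem_center_eq_mul_of_map_eq hz hb
  have hzb : MulAut.conj z (b * w) = b * w := by
    rw [MulAut.conj_apply, mul_inv_eq_iff_eq_mul, mem_center_iff.1 hz']
  have hwa : MulAut.conj a w = w := by
    rw [MulAut.conj_apply, mul_inv_eq_iff_eq_mul, mem_center_iff.1 hw]
  rw [← mul_inv_eq_one]
  calc ⁅a * z, b * w⁆ * ⁅a, b⁆⁻¹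
    _ = MulAut.conj a (MulAut.conj z (b * w)) * (b * w)⁻¹ * ⁅a, b⁆⁻¹ := by
      simp only [MulAut.conj_apply]; group
    _ = a * b * a⁻¹ * MulAut.conj a w * (b * w)⁻¹ * ⁅a, b⁆⁻¹ := by
      rw [hzb]; simp only [MulAut.conj_apply]; group
    _ = 1 := by rw [hwa]; group

theorem commutatorElement_mem_center (hz : π.ker ≤ center E) {a b : E}
    (h : Commute (π a) (π b)) : ⁅a, b⁆ ∈ center E :=
  hz <| by rwa [MonoidHom.mem_ker, map_commutatorElement, commutatorElement_eq_one_iff_commute]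

theorem orderOf_commutatorElement_dvd (hz : π.ker ≤ center E) {a b : E}
    (h : Commute (π a) (π b)) : orderOf ⁅a, b⁆ ∣ orderOf (π a) := by
  have hpow : a ^ orderOf (π a) ∈ center E :=
    hz (by rw [MonoidHom.mem_ker, map_pow, pow_orderOf_eq_one])
  rw [orderOf_dvd_iff_pow_eq_one, ← zpow_natCast,
    ← commutatorElement_zpow_left_of_mem_center (commutatorElement_mem_center hz h), zpow_natCast,
    commutatorElement_eq_one_iff_commute]
  exact (mem_center_iff.1 hpow b).symm

end CentralExtension

section DeepCommute

open Subgroup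
open scoped commutatorElement

variable {G : Type u} {E : Type v} [Group G] [Group E] {π : E →* G} {x y : G}

/-- `x` and `y` commute deeply with respect to `π : E →* G`: all their preimages commute. This is
adjacency in the deep commuting graph, except that an element may commute deeply with itself. -/
def DeepCommute (π : E →* G) (x y : G) : Prop :=
  ∀ a b : E, π a = x → π b = y → Commute a b

/-- The image in `G` of the centralizer of the fibre of `π : E →* G` over `x`. In a central
extension it consists of the elements that commute deeply with `x`. -/
def deepCentralizer (π : E →* G) (x : G) : Subgroup G :=
  (centralizer (π ⁻¹' {x})).map π

theorem mem_deepCentralizer_iff (hπ : IsCentralExtension π) :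
    y ∈ deepCentralizer π x ↔ DeepCommute π x y := by
  simp only [deepCentralizer, mem_map, mem_centralizer_iff, Set.mem_preimage,
    Set.mem_singleton_iff]
  constructor
  · rintro ⟨b, hb, rfl⟩ a b' ha hb'
    exact commute_of_map_eq hπ.ker_le_center rfl hb' (hb a ha)
  · intro h
    obtain ⟨b, rfl⟩ := hπ.surjective y
    exact ⟨b, fun a ha => h a b ha rfl, rfl⟩

namespace DeepCommute

theorem symm (h : DeepCommute π x y) : DeepCommute π y x :=
  fun a b ha hb => (h b a hb ha).symm

theorem commute (hs : Function.Surjective π) (h : DeepCommute π x y) : Commute x y := by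
  obtain ⟨a, rfl⟩ := hs x
  obtain ⟨b, rfl⟩ := hs y
  exact (h a b rfl rfl).map π

theorem refl (hz : π.ker ≤ center E) (x : G) : DeepCommute π x x :=
  fun a _ ha hb => commute_of_map_eq hz rfl (hb.trans ha.symm) (Commute.refl a)

theorem zpow_right (hπ : IsCentralExtension π) (h : DeepCommute π x y) (k : ℤ) :
    DeepCommute π x (y ^ k) := by
  rw [← mem_deepCentralizer_iff hπ] at h ⊢
  exact zpow_mem h k

theorem mul_right (hπ : IsCentralExtension π) {z : G} (hy : DeepCommute π x y)
    (hz : DeepCommute π x z) : DeepCommute π x (y * z) := by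
  rw [← mem_deepCentralizer_iff hπ] at hy hz ⊢
  exact mul_mem hy hz

theorem one_left (hz : π.ker ≤ center E) (x : G) : DeepCommute π 1 x :=
  fun _ b ha _ => (mem_center_iff.1 (hz ha) b).symm

theorem of_coprime_orderOf (hz : π.ker ≤ center E) (hxy : Commute x y)
    (h : (orderOf x).Coprime (orderOf y)) : DeepCommute π x y := by
  rintro a b rfl rfl
  rw [← commutatorElement_eq_one_iff_commute, ← orderOf_eq_one_iff]
  refine Nat.eq_one_of_dvd_coprimes h (orderOf_commutatorElement_dvd hz hxy) ?_
  rw [← commutatorElement_inv, orderOf_inv]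
  exact orderOf_commutatorElement_dvd hz hxy.symm

/-- Conjugation by a lift of `g` fixes the central commutator `c` of lifts of `x` and `y`, but turns
it into `c ^ k`; hence the order of `c` divides `k - 1` as well as `orderOf x`. -/
theorem of_conj_eq_zpow (hπ : IsCentralExtension π) (hxy : Commute x y) {g : G} {k : ℤ}
    (hgx : g * x * g⁻¹ = x ^ k) (hgy : Commute g y) (hk : IsCoprime (k - 1) (orderOf x)) :
    DeepCommute π x y := by
  rintro a b rfl rfl
  obtain ⟨t, rfl⟩ := hπ.surjective g
  have hz := hπ.ker_le_center
  have hc : ⁅a, b⁆ ∈ center E := commutatorElement_mem_center hz hxy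
  have hck : ⁅a, b⁆ = ⁅a, b⁆ ^ k := calc
    ⁅a, b⁆ = t * ⁅a, b⁆ * t⁻¹ := by rw [mem_center_iff.1 hc t, mul_inv_cancel_right]
    _ = ⁅t * a * t⁻¹, t * b * t⁻¹⁆ := conjugate_commutatorElement _ _ _
    _ = ⁅a ^ k, b⁆ := commutatorElement_eq_of_map_eq hz (by simpa using hgx) (by simp [hgy.eq])
    _ = ⁅a, b⁆ ^ k := commutatorElement_zpow_left_of_mem_center hc k
  have hdvd : (orderOf ⁅a, b⁆ : ℤ) ∣ k - 1 := by
    rw [orderOf_dvd_iff_zpow_eq_one, zpow_sub_one, ← hck, mul_inv_cancel]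
  have hunit := hk.isUnit_of_dvd' hdvd
    (Int.natCast_dvd_natCast.2 (orderOf_commutatorElement_dvd hz hxy))
  rwa [Int.ofNat_isUnit, Nat.isUnit_iff, orderOf_eq_one_iff,
    commutatorElement_eq_one_iff_commute] at hunit

end DeepCommute

end DeepCommute

section ReducedGraph

open Subgroup

theorem connected_iff_natCard_connectedComponent_eq_one {V : Type*} {Γ : SimpleGraph V} :
    Γ.Connected ↔ Nat.card Γ.ConnectedComponent = 1 := by
  rw [Nat.card_eq_one_iff_unique]
  constructor
  · intro h
    have := h.nonempty
    exact ⟨h.preconnected.subsingleton_connectedComponent,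
      ⟨Γ.connectedComponentMk (Classical.arbitrary V)⟩⟩
  · rintro ⟨_, ⟨C⟩⟩
    obtain ⟨v, -⟩ := C.exists_rep
    exact (SimpleGraph.connected_iff_exists_forall_reachable _).2
      ⟨v, fun w => SimpleGraph.ConnectedComponent.eq.1 (Subsingleton.elim _ _)⟩

theorem natCard_connectedComponent_eq_ncard_range {V β : Type*} {Γ : SimpleGraph V} {f : V → β}
    (h : ∀ v w, Γ.Reachable v w ↔ f v = f w) :
    Nat.card Γ.ConnectedComponent = (Set.range f).ncard :=
  Nat.card_congr ((Quot.congrRight h).trans (Setoid.quotientKerEquivRange f))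

variable {G : Type u} {E : Type v} [Group G] [Group E] {π : E →* G} {x y z : G}

theorem compl_universalVerts_deepCommutingGraph (hπ : IsCentralExtension π) (hG : center G = ⊥) :
    (deepCommutingGraph π).universalVertsᶜ = {1}ᶜ := by
  refine congrArg compl (Set.ext fun x => ⟨fun hx => ?_, ?_⟩)
  · rw [Set.mem_singleton_iff, ← mem_bot, ← hG, mem_center_iff]
    intro y
    by_cases hxy : x = y
    · rw [hxy]
    · exact (DeepCommute.commute hπ.surjective (hx hxy).2).symm
  · rintro rfl y hy
    exact ⟨hy, DeepCommute.one_left hπ.ker_le_center y⟩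

/-- `x` and `y` are vertices of the reduced deep commuting graph, in the same component. -/
def DeepLinked (π : E →* G) (x y : G) : Prop :=
  ∃ hx hy, (reducedGraph (deepCommutingGraph π)).Reachable ⟨x, hx⟩ ⟨y, hy⟩

theorem DeepLinked.symm (h : DeepLinked π x y) : DeepLinked π y x :=
  let ⟨hx, hy, h⟩ := h
  ⟨hy, hx, h.symm⟩

theorem DeepLinked.trans (hxy : DeepLinked π x y) (hyz : DeepLinked π y z) : DeepLinked π x z :=
  let ⟨hx, _, hxy⟩ := hxy
  let ⟨_, hz, hyz⟩ := hyz
  ⟨hx, hz, hxy.trans hyz⟩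

theorem DeepCommute.deepLinked (hπ : IsCentralExtension π) (hG : center G = ⊥) (hx : x ≠ 1)
    (hy : y ≠ 1) (h : DeepCommute π x y) : DeepLinked π x y := by
  have hvert := compl_universalVerts_deepCommutingGraph hπ hG
  refine ⟨hvert.ge hx, hvert.ge hy, ?_⟩
  by_cases hxy : x = y
  · subst hxy
    rfl
  · exact SimpleGraph.Adj.reachable ⟨hxy, h⟩

theorem DeepLinked.eq_of_forall_commute {β : Type*} (hπ : IsCentralExtension π)
    (hG : center G = ⊥) {f : G → β} (hf : ∀ x y, x ≠ 1 → y ≠ 1 → Commute x y → f x = f y)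
    (h : DeepLinked π x y) : f x = f y := by
  obtain ⟨hx, hy, ⟨p⟩⟩ := h
  have hvert := compl_universalVerts_deepCommutingGraph hπ hG
  have hwalk {v w} (p : (reducedGraph (deepCommutingGraph π)).Walk v w) : f v.1 = f w.1 := by
    induction p with
    | nil => rfl
    | cons hadj _ ih =>
      exact (hf _ _ (hvert.le (Subtype.prop _)) (hvert.le (Subtype.prop _))
        (DeepCommute.commute hπ.surjective hadj.2)).trans ih
  exact hwalk p

theorem natCard_connectedComponent_reducedGraph_eq_ncard_image {β : Type*}
    (hπ : IsCentralExtension π) (hG : center G = ⊥) {f : G → β}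
    (hf : ∀ x y, x ≠ 1 → y ≠ 1 → (DeepLinked π x y ↔ f x = f y)) :
    Nat.card (reducedGraph (deepCommutingGraph π)).ConnectedComponent = (f '' {1}ᶜ).ncard := by
  have hvert := compl_universalVerts_deepCommutingGraph hπ hG
  rw [natCard_connectedComponent_eq_ncard_range (f := fun v => f v.1), Set.range_comp' f,
    Subtype.range_coe, hvert]
  intro v w
  rw [← hf v w (hvert.le v.2) (hvert.le w.2)]
  exact ⟨fun h => ⟨v.2, w.2, h⟩, fun ⟨_, _, h⟩ => h⟩

end ReducedGraph

section Perm

open Equiv Equiv.Perm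

variable {α : Type*} [Fintype α] [DecidableEq α] {x y z : Perm α} {s : Finset α}

theorem exists_conj_eq_of_support_subset (h : x.cycleType = z.cycleType) (hx : x.support ⊆ s)
    (hz : z.support ⊆ s) : ∃ t : Perm α, t.support ⊆ s ∧ t * x * t⁻¹ = z := by
  have hrange {w : Perm α} :
      w ∈ (ofSubtype : Perm {a // a ∈ s} →* Perm α).range ↔ w.support ⊆ s :=
    mem_range_ofSubtype_iff
  obtain ⟨x', rfl⟩ := hrange.2 hx
  obtain ⟨z', rfl⟩ := hrange.2 hz
  rw [cycleType_ofSubtype, cycleType_ofSubtype, ← isConj_iff_cycleType_eq, isConj_iff] at h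
  obtain ⟨t, rfl⟩ := h
  exact ⟨ofSubtype t, hrange.1 ⟨t, rfl⟩, by simp only [map_mul, map_inv]⟩

theorem exists_conj_eq_pow_of_isCycle (hx : x.IsCycle) {k : ℕ} (hk : k.Coprime x.support.card) :
    ∃ t : Perm α, t.support ⊆ x.support ∧ t * x * t⁻¹ = x ^ k := by
  rw [← hx.orderOf] at hk
  have hsupp := support_pow_coprime hk
  refine exists_conj_eq_of_support_subset ?_ subset_rfl hsupp.le
  rw [hx.cycleType, (hx.pow_iff.2 hk).cycleType, hsupp]

theorem sign_eq_one_iff_odd_of_isCycle (hx : x.IsCycle) : sign x = 1 ↔ Odd x.support.card := by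
  rw [hx.sign, neg_eq_iff_eq_neg]
  exact neg_one_pow_eq_neg_one_iff_odd (by decide)

theorem eq_one_of_sign_eq_one_of_card_support_le_two (hx : sign x = 1)
    (hcard : x.support.card ≤ 2) : x = 1 := by
  rcases hcard.lt_or_eq with hlt | heq
  · exact card_support_le_one.1 (Nat.le_of_lt_succ hlt)
  · rw [(card_support_eq_two.1 heq).sign_eq] at hx
    exact absurd hx (by decide)

theorem mem_zpowers_of_commute_of_isCycle (hx : x.IsCycle)
    (hcard : Fintype.card α ≤ x.support.card + 2) (hxs : sign x = 1) (hys : sign y = 1)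
    (hxy : Commute x y) : y ∈ Subgroup.zpowers x := by
  obtain ⟨hinv, k, hk⟩ := hx.commute_iff.1 hxy.symm
  have hagree : ∀ a ∈ x.support, (x ^ k) a = y a := fun a ha => by
    rw [show x ^ k = _ from hk, ofSubtype_apply_of_mem _ ha, subtypePerm_apply]
  have hfix : ((x ^ k)⁻¹ * y).support ⊆ x.supportᶜ := fun a ha => by
    rw [Finset.mem_compl]
    intro hax
    rw [mem_support, Perm.mul_apply, ← hagree a hax] at ha
    exact ha ((x ^ k).symm_apply_apply a)
  have hle : ((x ^ k)⁻¹ * y).support.card ≤ 2 := by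
    have := Finset.card_le_card hfix
    rw [Finset.card_compl] at this
    omega
  have hsign : sign ((x ^ k)⁻¹ * y) = 1 := by simp [hxs, hys]
  exact ⟨k, inv_mul_eq_one.1 (eq_one_of_sign_eq_one_of_card_support_le_two hsign hle)⟩

theorem exists_isThreeCycle_support_eq (hs : s.card = 3) :
    ∃ t : Perm α, t.IsThreeCycle ∧ t.support = s := by
  obtain ⟨a, b, c, hab, hac, hbc, rfl⟩ := Finset.card_eq_three.1 hs
  have hsupp := support_swap_mul_swap (x := a) (y := b) (z := c) (by simp [hab, hac, hbc])
  exact ⟨_, card_support_eq_three_iff.1 (by rw [hsupp, hs]), hsupp⟩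

theorem exists_isThreeCycle_disjoint_support (hs : s.card + 3 ≤ Fintype.card α) :
    ∃ t : Perm α, t.IsThreeCycle ∧ Disjoint t.support s := by
  obtain ⟨u, hu, hu3⟩ := Finset.exists_subset_card_eq (s := sᶜ) (n := 3)
    (by rw [Finset.card_compl]; omega)
  obtain ⟨t, ht, rfl⟩ := exists_isThreeCycle_support_eq hu3
  exact ⟨t, ht, Finset.subset_compl_iff_disjoint_right.1 hu⟩

theorem exists_card_eq_three_disjoint_map_of_involutive (hx : Function.Involutive x)
    (hcard : 5 ≤ x.support.card) :
    ∃ u : Finset α, u.card = 3 ∧ Disjoint u (u.map x.toEmbedding) := by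
  have hpick (u : Finset α) (hu : u.card ≤ 4) : ∃ c, x c ≠ c ∧ c ∉ u := by
    obtain ⟨c, hc, hcu⟩ := Finset.exists_mem_notMem_of_card_lt_card (hu.trans_lt hcard)
    exact ⟨c, mem_support.1 hc, hcu⟩
  obtain ⟨a, ha, -⟩ := hpick ∅ (by simp)
  obtain ⟨b, hb, hbu⟩ := hpick {a, x a} (Finset.card_le_two.trans (by norm_num))
  obtain ⟨c, hc, hcu⟩ := hpick {a, x a, b, x b} Finset.card_le_four
  simp only [Finset.mem_insert, Finset.mem_singleton, not_or] at hbu hcu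
  refine ⟨{a, b, c}, Finset.card_eq_three.2
    ⟨a, b, c, Ne.symm hbu.1, Ne.symm hcu.1, Ne.symm hcu.2.2.1, rfl⟩, ?_⟩
  have hsymm {p q : α} (h : p ≠ x q) : x p ≠ q := fun e => h (by rw [← e, hx])
  simp only [Finset.map_insert, Finset.map_singleton, coe_toEmbedding,
    Finset.disjoint_insert_left, Finset.disjoint_singleton_left, Finset.mem_insert,
    Finset.mem_singleton, not_or]
  exact ⟨⟨ha.symm, (hsymm hbu.2).symm, (hsymm hcu.2.1).symm⟩,
    ⟨hbu.2, hb.symm, (hsymm hcu.2.2.2).symm⟩, hcu.2.1, hcu.2.2.2, hc.symm⟩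

theorem exists_isThreeCycle_disjoint_conj_of_sq_eq_one (hx : x ^ 2 = 1)
    (hcard : 5 ≤ x.support.card) : ∃ t : Perm α, t.IsThreeCycle ∧ t.Disjoint (x * t * x⁻¹) := by
  have hinv : Function.Involutive x := fun a => by rw [← Perm.mul_apply, ← sq, hx, Perm.one_apply]
  obtain ⟨u, hu3, hu⟩ := exists_card_eq_three_disjoint_map_of_involutive hinv hcard
  obtain ⟨t, ht, rfl⟩ := exists_isThreeCycle_support_eq hu3
  exact ⟨t, ht, by rwa [disjoint_iff_disjoint_support, support_conj]⟩

theorem card_support_of_mem_cycleFactorsFinset (hp : (orderOf x).Prime)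
    (hy : y ∈ x.cycleFactorsFinset) : y.support.card = orderOf x := by
  have hmem : y.support.card ∈ x.cycleType := by
    rw [cycleType_def]
    exact Multiset.mem_map_of_mem _ hy
  exact ((Nat.dvd_prime hp).1 (dvd_of_mem_cycleType hmem)).resolve_left
    (one_lt_of_mem_cycleType hmem).ne'

theorem cycleFactorsFinset_nonempty (hx : x ≠ 1) : x.cycleFactorsFinset.Nonempty :=
  Finset.nonempty_iff_ne_empty.2 (mt cycleFactorsFinset_eq_empty_iff.1 hx)

theorem cycleType_eq_singleton_iff {n : ℕ} :
    x.cycleType = {n} ↔ x.IsCycle ∧ x.support.card = n := by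
  constructor
  · intro h
    exact ⟨card_cycleType_eq_one.1 (by rw [h, Multiset.card_singleton]),
      by rw [← sum_cycleType, h, Multiset.sum_singleton]⟩
  · rintro ⟨h, rfl⟩
    exact h.cycleType

theorem mem_of_forall_mem_cycleFactorsFinset {H : Subgroup (Perm α)}
    (h : ∀ c ∈ x.cycleFactorsFinset, c ∈ H) : x ∈ H := by
  rw [← cycleFactorsFinset_noncommProd x]
  exact H.noncommProd_mem _ h

theorem exists_disjoint_sign_eq (hs : s.card + 2 ≤ Fintype.card α) (ε : ℤˣ) :
    ∃ τ : Perm α, Disjoint τ.support s ∧ sign τ = ε := by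
  rcases Int.units_eq_one_or ε with rfl | rfl
  · exact ⟨1, by rw [support_one]; exact Finset.disjoint_empty_left s, sign_one⟩
  · obtain ⟨u, hu, hu2⟩ := Finset.exists_subset_card_eq (s := sᶜ) (n := 2)
      (by rw [Finset.card_compl]; omega)
    obtain ⟨a, b, hab, rfl⟩ := Finset.card_eq_two.1 hu2
    rw [← support_swap hab] at hu
    exact ⟨swap a b, Finset.subset_compl_iff_disjoint_right.1 hu, sign_swap hab⟩

end Perm

section CyclicSubgroup

open Subgroup

variable {G : Type*} [Group G] {x y : G}

theorem zpowers_eq_zpowers_iff_orderOf_eq (hx : IsOfFinOrder x) (hy : y ∈ zpowers x) :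
    zpowers y = zpowers x ↔ orderOf y = orderOf x := by
  have : Finite (zpowers x) := (finite_zpowers.2 hx).to_subtype
  constructor
  · intro h
    rw [← Nat.card_zpowers, ← Nat.card_zpowers, h]
  · intro h
    refine eq_of_le_of_card_ge (zpowers_le.2 hy) ?_
    rw [Nat.card_zpowers, Nat.card_zpowers, h]

theorem zpowers_eq_zpowers_of_prime_orderOf (hp : (orderOf x).Prime) (hy : y ∈ zpowers x)
    (hy1 : y ≠ 1) : zpowers y = zpowers x :=
  (zpowers_eq_zpowers_iff_orderOf_eq (orderOf_pos_iff.1 hp.pos) hy).2 <|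
    ((Nat.dvd_prime hp).1 (orderOf_dvd_of_mem_zpowers hy)).resolve_left
      (mt orderOf_eq_one_iff.1 hy1)

open Classical in
theorem card_filter_zpowers_eq_totient [Fintype G] (x : G) :
    (Finset.univ.filter fun y => zpowers y = zpowers x).card = (orderOf x).totient := by
  have hfilter : (Finset.univ.filter fun y => zpowers y = zpowers x) =
      (Finset.univ.filter fun z : zpowers x => orderOf z = orderOf x).map
        (Function.Embedding.subtype _) := by
    ext y
    simp only [Finset.mem_filter, Finset.mem_univ, true_and, Finset.mem_map,
      Function.Embedding.subtype_apply, Subtype.exists, exists_and_right, exists_eq_right,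
      orderOf_mk]
    refine ⟨fun h => ?_, fun ⟨hy, h⟩ => ?_⟩
    · have hy : y ∈ zpowers x := h ▸ mem_zpowers y
      exact ⟨hy, (zpowers_eq_zpowers_iff_orderOf_eq (isOfFinOrder_of_finite x) hy).1 h⟩
    · exact (zpowers_eq_zpowers_iff_orderOf_eq (isOfFinOrder_of_finite x) hy).2 h
  rw [hfilter, Finset.card_map,
    IsCyclic.card_orderOf_eq_totient (dvd_of_eq Fintype.card_zpowers.symm)]

open Classical in
theorem card_image_zpowers_mul_totient [Finite G] {S : Finset G} {n : ℕ}
    (hS : ∀ x y, zpowers y = zpowers x → x ∈ S → y ∈ S) (hn : ∀ x ∈ S, orderOf x = n) :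
    (S.image zpowers).card * n.totient = S.card := by
  have := Fintype.ofFinite G
  rw [Finset.card_eq_sum_card_image zpowers S]
  refine (Finset.sum_const_nat fun K hK => ?_).symm
  obtain ⟨x, hx, rfl⟩ := Finset.mem_image.1 hK
  rw [← hn x hx, ← card_filter_zpowers_eq_totient]
  congr 1
  ext y
  simpa using fun h => hS x y h hx

end CyclicSubgroup

section LongPrimeCycle

open Equiv Equiv.Perm Subgroup

variable {α : Type*} [Fintype α] [DecidableEq α] {x y : Perm α}

theorem support_eq_of_zpowers_eq (h : zpowers y = zpowers x) : y.support = x.support := by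
  have hle {u v : Perm α} (huv : zpowers u = zpowers v) : u.support ⊆ v.support := by
    obtain ⟨k, rfl⟩ := zpowers_le.1 huv.le
    exact support_zpow_le v k
  exact (hle h).antisymm (hle h.symm)

omit [Fintype α] [DecidableEq α] in
theorem isCycle_of_zpowers_eq [Finite α] (h : zpowers y = zpowers x) (hx : x.IsCycle) :
    y.IsCycle := by
  classical
  have := Fintype.ofFinite α
  obtain ⟨k, rfl⟩ := zpowers_le.1 h.ge
  exact hx.of_zpow (support_eq_of_zpowers_eq h).le

theorem cycleType_eq_singleton_of_zpowers_eq {n : ℕ} (h : zpowers y = zpowers x)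
    (hx : x.cycleType = {n}) : y.cycleType = {n} := by
  rw [cycleType_eq_singleton_iff] at hx ⊢
  exact ⟨isCycle_of_zpowers_eq h hx.1, by rw [support_eq_of_zpowers_eq h, hx.2]⟩

open Classical in
theorem card_image_zpowers_cycleType_eq_singleton {p : ℕ} (hp : p.Prime)
    (hpα : p ≤ Fintype.card α) :
    (Finset.image zpowers {x : Perm α | x.cycleType = {p}}).card =
      (p - 2).factorial * (Fintype.card α).choose p := by
  have hcount := card_image_zpowers_mul_totient (S := {x : Perm α | x.cycleType = {p}}) (n := p)
    (fun x y h hx => by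
      simpa using cycleType_eq_singleton_of_zpowers_eq h (Finset.mem_filter.1 hx).2)
    (fun x hx => by
      rw [← lcm_cycleType, (Finset.mem_filter.1 hx).2, Multiset.lcm_singleton, normalize_eq])
  rw [card_of_cycleType_singleton hp.two_le hpα, Nat.totient_prime hp] at hcount
  have hfact : (p - 1).factorial = (p - 1) * (p - 2).factorial :=
    (Nat.mul_factorial_pred (Nat.sub_pos_of_lt hp.one_lt).ne').symm
  rw [hfact, mul_assoc, mul_comm (p - 1)] at hcount
  exact Nat.eq_of_mul_eq_mul_right (Nat.sub_pos_of_lt hp.one_lt) hcount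

/-- A long prime cycle is a cycle of prime length that fixes at most two points. The long prime
cycles are the elements outside the main component of the reduced deep commuting graph. -/
structure IsLongPrimeCycle (x : Perm α) : Prop where
  isCycle : x.IsCycle
  prime_card_support : x.support.card.Prime
  card_le : Fintype.card α ≤ x.support.card + 2

namespace IsLongPrimeCycle

theorem of_zpowers_eq (hx : IsLongPrimeCycle x) (h : zpowers y = zpowers x) :
    IsLongPrimeCycle y := by
  have hsupp := support_eq_of_zpowers_eq h
  exact ⟨isCycle_of_zpowers_eq h hx.isCycle, hsupp ▸ hx.prime_card_support, hsupp ▸ hx.card_le⟩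

theorem sign_eq_one (hx : IsLongPrimeCycle x) (hα : 5 ≤ Fintype.card α) : sign x = 1 := by
  have hle := hx.card_le
  exact (sign_eq_one_iff_odd_of_isCycle hx.isCycle).2
    (hx.prime_card_support.odd_of_ne_two (by omega))

theorem zpowers_eq_of_commute (hx : IsLongPrimeCycle x) (hα : 5 ≤ Fintype.card α)
    (hys : sign y = 1) (hy1 : y ≠ 1) (hxy : Commute x y) : zpowers y = zpowers x :=
  zpowers_eq_zpowers_of_prime_orderOf (hx.isCycle.orderOf ▸ hx.prime_card_support)
    (mem_zpowers_of_commute_of_isCycle hx.isCycle hx.card_le (hx.sign_eq_one hα) hys hxy) hy1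

theorem of_commute (hx : IsLongPrimeCycle x) (hα : 5 ≤ Fintype.card α) (hys : sign y = 1)
    (hy1 : y ≠ 1) (hxy : Commute x y) : IsLongPrimeCycle y :=
  hx.of_zpowers_eq (hx.zpowers_eq_of_commute hα hys hy1 hxy)

end IsLongPrimeCycle

open Classical in
/-- The invariant that separates the components of the reduced deep commuting graph: the subgroup
generated by a long prime cycle, and the trivial subgroup for any other permutation. -/
noncomputable def longPrimeSubgroup (x : Perm α) : Subgroup (Perm α) :=
  if IsLongPrimeCycle x then zpowers x else ⊥

theorem longPrimeSubgroup_eq_of_commute (hα : 5 ≤ Fintype.card α) (hxs : sign x = 1)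
    (hys : sign y = 1) (hx1 : x ≠ 1) (hy1 : y ≠ 1) (hxy : Commute x y) :
    longPrimeSubgroup x = longPrimeSubgroup y := by
  by_cases hx : IsLongPrimeCycle x
  · rw [longPrimeSubgroup, longPrimeSubgroup, if_pos hx, if_pos (hx.of_commute hα hys hy1 hxy),
      hx.zpowers_eq_of_commute hα hys hy1 hxy]
  · have hy : ¬ IsLongPrimeCycle y := fun hy => hx (hy.of_commute hα hxs hx1 hxy.symm)
    rw [longPrimeSubgroup, longPrimeSubgroup, if_neg hx, if_neg hy]

/-- The possible lengths of a long prime cycle of `n` points. -/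
def longPrimes (n : ℕ) : Finset ℕ := (Finset.Icc (n - 2) n).filter Nat.Prime

theorem isLongPrimeCycle_iff :
    IsLongPrimeCycle x ↔ ∃ p ∈ longPrimes (Fintype.card α), x.cycleType = {p} := by
  simp only [cycleType_eq_singleton_iff, longPrimes, Finset.mem_filter, Finset.mem_Icc,
    tsub_le_iff_right]
  constructor
  · intro hx
    exact ⟨_, ⟨⟨hx.card_le, Finset.card_le_univ _⟩, hx.prime_card_support⟩, hx.isCycle, rfl⟩
  · rintro ⟨_, ⟨⟨hle, -⟩, hprime⟩, hcycle, rfl⟩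
    exact ⟨hcycle, hprime, hle⟩

open Classical in
theorem card_image_zpowers_isLongPrimeCycle :
    (Finset.image zpowers {x : Perm α | IsLongPrimeCycle x}).card =
      ∑ p ∈ longPrimes (Fintype.card α), (p - 2).factorial * (Fintype.card α).choose p := by
  have hunion : Finset.image zpowers {x : Perm α | IsLongPrimeCycle x} =
      (longPrimes (Fintype.card α)).biUnion fun p =>
        Finset.image zpowers {x : Perm α | x.cycleType = {p}} := by
    rw [← Finset.biUnion_image]
    congr 1
    ext x
    simp [isLongPrimeCycle_iff]
  rw [hunion, Finset.card_biUnion]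
  · refine Finset.sum_congr rfl fun p hp => ?_
    simp only [longPrimes, Finset.mem_filter, Finset.mem_Icc] at hp
    exact card_image_zpowers_cycleType_eq_singleton hp.2 hp.1.2
  · intro p _ q _ hpq
    refine Finset.disjoint_left.2 fun K hKp hKq => hpq ?_
    obtain ⟨x, hx, rfl⟩ := Finset.mem_image.1 hKp
    obtain ⟨y, hy, hyx⟩ := Finset.mem_image.1 hKq
    have hxq := cycleType_eq_singleton_of_zpowers_eq hyx.symm (Finset.mem_filter.1 hy).2
    rwa [(Finset.mem_filter.1 hx).2, Multiset.singleton_inj] at hxq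

theorem image_longPrimeSubgroup_compl_one (hα : 6 ≤ Fintype.card α) :
    (fun x : alternatingGroup α => longPrimeSubgroup (x : Perm α)) '' {1}ᶜ =
      insert ⊥ (zpowers '' {x : Perm α | IsLongPrimeCycle x}) := by
  ext K
  simp only [Set.mem_image, Set.mem_insert_iff]
  constructor
  · rintro ⟨x, -, rfl⟩
    by_cases hx : IsLongPrimeCycle (x : Perm α)
    · exact Or.inr ⟨x, hx, (if_pos hx).symm⟩
    · exact Or.inl (if_neg hx)
  · rintro (rfl | ⟨x, hx, rfl⟩)
    · obtain ⟨t, ht, -⟩ := exists_isThreeCycle_disjoint_support (α := α) (s := ∅)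
        (by rw [Finset.card_empty]; omega)
      have hlong : ¬ IsLongPrimeCycle t := fun h => by
        have := h.card_le
        rw [ht.card_support] at this
        omega
      exact ⟨⟨t, ht.mem_alternatingGroup⟩, fun h => ht.ne_one (congrArg Subtype.val h),
        if_neg hlong⟩
    · exact ⟨⟨x, hx.sign_eq_one (by omega)⟩, fun h => hx.isCycle.ne_one (congrArg Subtype.val h),
        if_pos hx⟩

theorem ncard_image_longPrimeSubgroup_compl_one (hα : 6 ≤ Fintype.card α) :
    ((fun x : alternatingGroup α => longPrimeSubgroup (x : Perm α)) '' {1}ᶜ).ncard =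
      (∑ p ∈ longPrimes (Fintype.card α), (p - 2).factorial * (Fintype.card α).choose p) + 1 := by
  classical
  have hbot : ⊥ ∉ zpowers '' {x : Perm α | IsLongPrimeCycle x} := by
    rintro ⟨x, hx, hbot⟩
    exact hx.isCycle.ne_one (zpowers_eq_bot.1 hbot)
  rw [image_longPrimeSubgroup_compl_one hα, Set.ncard_insert_of_notMem hbot (Set.toFinite _),
    ← card_image_zpowers_isLongPrimeCycle, ← Set.ncard_coe_finset]
  simp

end LongPrimeCycle

section AlternatingGroup

open Equiv Equiv.Perm Subgroup

variable {α : Type u} [Fintype α] [DecidableEq α] {E : Type v} [Group E]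
  {π : E →* alternatingGroup α} {x y : alternatingGroup α}

theorem center_alternatingGroup_eq_bot (hα : 4 ≤ Fintype.card α) :
    center (alternatingGroup α) = ⊥ :=
  alternatingGroup.center_eq_bot (by rwa [Nat.card_eq_fintype_card])

theorem alternatingGroup_commute_iff : Commute x y ↔ Commute (x : Perm α) y :=
  Subtype.ext_iff

theorem ne_one_of_isCycle (hx : (x : Perm α).IsCycle) : x ≠ 1 :=
  fun h => hx.ne_one (congrArg Subtype.val h)

theorem orderOf_eq_three_of_isThreeCycle (hx : (x : Perm α).IsThreeCycle) : orderOf x = 3 := by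
  rw [← orderOf_coe, hx.orderOf]

theorem DeepCommute.of_disjoint_of_card_support_add_le (hπ : IsCentralExtension π)
    (hx : (x : Perm α).IsCycle) (hxy : (x : Perm α).Disjoint y)
    (hcard : (x : Perm α).support.card + (y : Perm α).support.card + 2 ≤ Fintype.card α) :
    DeepCommute π x y := by
  have hodd := (sign_eq_one_iff_odd_of_isCycle hx).1 (mem_alternatingGroup.1 x.2)
  obtain ⟨t, ht, htx⟩ := exists_conj_eq_pow_of_isCycle hx (Nat.coprime_two_left.2 hodd)
  -- The parity of `t` is corrected away from the supports of `x` and `y`.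
  obtain ⟨τ, hτ, hsign⟩ := exists_disjoint_sign_eq
    (s := (x : Perm α).support ∪ (y : Perm α).support)
    ((Nat.add_le_add_right (Finset.card_union_le _ _) 2).trans hcard) (sign t)
  rw [Finset.disjoint_union_right] at hτ
  have hτx : Commute τ ((x : Perm α) ^ 2) :=
    (disjoint_iff_disjoint_support.2 hτ.1).commute.pow_right 2
  have hτy : Commute τ y := (disjoint_iff_disjoint_support.2 hτ.2).commute
  have hty : Commute t y := (hxy.mono ht subset_rfl).commute
  refine of_conj_eq_zpow hπ (g := ⟨τ * t, ?_⟩) (k := 2) (alternatingGroup_commute_iff.2 hxy.commute)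
    (Subtype.ext ?_) (alternatingGroup_commute_iff.2 (hτy.mul_left hty)) isCoprime_one_left
  · rw [mem_alternatingGroup, map_mul, hsign, Int.units_mul_self]
  · calc τ * t * x * (τ * t)⁻¹ = τ * (t * x * t⁻¹) * τ⁻¹ := by group
      _ = (x : Perm α) ^ 2 := by rw [htx, hτx.eq, mul_inv_cancel_right]

theorem DeepCommute.of_disjoint_of_coprime_three (hπ : IsCentralExtension π)
    (hx : (x : Perm α).IsCycle) (hxy : (x : Perm α).Disjoint y)
    (h3 : Nat.Coprime 3 (x : Perm α).support.card) : DeepCommute π x y := by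
  have hodd := (sign_eq_one_iff_odd_of_isCycle hx).1 (mem_alternatingGroup.1 x.2)
  obtain ⟨t, ht, htx⟩ := exists_conj_eq_pow_of_isCycle hx (Nat.coprime_two_left.2 hodd)
  have hty : Commute t y := (hxy.mono ht subset_rfl).commute
  -- Squaring makes the conjugating permutation even but raises the exponent from `2` to `4`, and
  -- the factor `4 - 1 = 3` is what the length has to avoid.
  refine of_conj_eq_zpow hπ (g := ⟨t * t, ?_⟩) (k := 4) (alternatingGroup_commute_iff.2 hxy.commute)
    (Subtype.ext ?_) (alternatingGroup_commute_iff.2 (hty.mul_left hty)) ?_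
  · rw [mem_alternatingGroup, map_mul, Int.units_mul_self]
  · calc t * t * x * (t * t)⁻¹ = t * (t * x * t⁻¹) * t⁻¹ := by group
      _ = (t * x * t⁻¹) ^ 2 := by rw [htx, ← conj_pow, htx]
      _ = (x : Perm α) ^ 4 := by rw [htx, ← pow_mul]
  · rw [← orderOf_coe, hx.orderOf]
    exact Nat.isCoprime_iff_coprime.2 h3

theorem deepLinked_of_isThreeCycle (hα : 8 ≤ Fintype.card α) (hπ : IsCentralExtension π)
    (hx : (x : Perm α).IsThreeCycle) (hy : (y : Perm α).IsThreeCycle) : DeepLinked π x y := by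
  have hdisj {u v : alternatingGroup α} (hu : (u : Perm α).IsThreeCycle)
      (hv : (v : Perm α).IsThreeCycle) (huv : (u : Perm α).Disjoint v) : DeepLinked π u v :=
    (DeepCommute.of_disjoint_of_card_support_add_le hπ hu.isCycle huv
      (by rwa [hu.card_support, hv.card_support])).deepLinked hπ
      (center_alternatingGroup_eq_bot (by omega)) (ne_one_of_isCycle hu.isCycle)
      (ne_one_of_isCycle hv.isCycle)
  by_cases hxy : (x : Perm α).Disjoint y
  · exact hdisj hx hy hxy
  · have hunion : ((x : Perm α).support ∪ (y : Perm α).support).card ≤ 5 := by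
      have hcard := Finset.card_union_add_card_inter (x : Perm α).support (y : Perm α).support
      rw [hx.card_support, hy.card_support] at hcard
      rw [disjoint_iff_disjoint_support, Finset.disjoint_iff_inter_eq_empty,
        ← Finset.card_eq_zero] at hxy
      omega
    obtain ⟨t, ht, htxy⟩ := exists_isThreeCycle_disjoint_support
      (s := (x : Perm α).support ∪ (y : Perm α).support) (by omega)
    rw [Finset.disjoint_union_right] at htxy
    lift t to alternatingGroup α using ht.mem_alternatingGroup
    exact (hdisj hx ht (disjoint_iff_disjoint_support.2 htxy.1.symm)).trans
      (hdisj ht hy (disjoint_iff_disjoint_support.2 htxy.2))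

theorem exists_isThreeCycle_deepLinked_of_card_support_add_three_le (hα : 4 ≤ Fintype.card α)
    (hπ : IsCentralExtension π) (hx : x ≠ 1) (h3 : (orderOf x).Coprime 3)
    (hcard : (x : Perm α).support.card + 3 ≤ Fintype.card α) :
    ∃ t : alternatingGroup α, (t : Perm α).IsThreeCycle ∧ DeepLinked π x t := by
  obtain ⟨t, ht, htx⟩ := exists_isThreeCycle_disjoint_support hcard
  lift t to alternatingGroup α using ht.mem_alternatingGroup
  rw [← orderOf_eq_three_of_isThreeCycle ht] at h3
  have hxt : Commute x t :=
    alternatingGroup_commute_iff.2 (disjoint_iff_disjoint_support.2 htx.symm).commute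
  exact ⟨t, ht, (DeepCommute.of_coprime_orderOf hπ.ker_le_center hxt h3).deepLinked hπ
    (center_alternatingGroup_eq_bot hα) hx (ne_one_of_isCycle ht.isCycle)⟩

/-- If `x` has too few fixed points for a disjoint three-cycle, then it moves some three-cycle `t`
to a disjoint one, and the link from `x` to `t` passes through `t * (x * t * x⁻¹)`. -/
theorem exists_isThreeCycle_deepLinked_of_orderOf_eq_two (hα : 8 ≤ Fintype.card α)
    (hπ : IsCentralExtension π) (hx : orderOf x = 2) :
    ∃ t : alternatingGroup α, (t : Perm α).IsThreeCycle ∧ DeepLinked π x t := by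
  have hx1 : x ≠ 1 := fun h => by simp [h] at hx
  by_cases hcard : (x : Perm α).support.card + 3 ≤ Fintype.card α
  · exact exists_isThreeCycle_deepLinked_of_card_support_add_three_le (by omega) hπ hx1
      (by rw [hx]; norm_num) hcard
  have hx2 : x ^ 2 = 1 := by rw [← hx, pow_orderOf_eq_one]
  obtain ⟨t, ht, htx⟩ := exists_isThreeCycle_disjoint_conj_of_sq_eq_one (x := (x : Perm α))
    (congrArg Subtype.val hx2) (by omega)
  lift t to alternatingGroup α using ht.mem_alternatingGroup
  obtain ⟨s, hs⟩ : ∃ s, s = x * t * x⁻¹ := ⟨_, rfl⟩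
  have hs3 : (s : Perm α).IsThreeCycle := by
    rw [hs]
    exact (cycleType_conj).trans ht
  have hts : (t : Perm α).Disjoint s := hs ▸ htx
  have hcomm : Commute t s := alternatingGroup_commute_iff.2 hts.commute
  have hts1 : t * s ≠ 1 := fun h =>
    ht.isCycle.ne_one (hts.mul_eq_one_iff.1 (congrArg Subtype.val h)).1
  have hxts : Commute x (t * s) := by
    rw [hs] at hcomm ⊢
    exact commute_mul_conj_of_sq_eq_one hx2 hcomm
  have hcop : (orderOf x).Coprime (orderOf (t * s)) := by
    have hdvd : orderOf (t * s) ∣ 3 := orderOf_dvd_of_pow_eq_one <| by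
      rw [hcomm.mul_pow, ← orderOf_eq_three_of_isThreeCycle ht, pow_orderOf_eq_one,
        orderOf_eq_three_of_isThreeCycle ht, ← orderOf_eq_three_of_isThreeCycle hs3,
        pow_orderOf_eq_one, one_mul]
    exact Nat.Coprime.coprime_dvd_right hdvd (by rw [hx]; norm_num)
  have hG := center_alternatingGroup_eq_bot (α := α) (by omega)
  have htts : DeepCommute π t (t * s) := (DeepCommute.refl hπ.ker_le_center t).mul_right hπ
    (DeepCommute.of_disjoint_of_card_support_add_le hπ ht.isCycle hts
      (by rwa [ht.card_support, hs3.card_support]))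
  exact ⟨t, ht, ((DeepCommute.of_coprime_orderOf hπ.ker_le_center hxts hcop).deepLinked hπ hG hx1
    hts1).trans (htts.symm.deepLinked hπ hG hts1 (ne_one_of_isCycle ht.isCycle))⟩

theorem DeepCommute.of_mem_cycleFactorsFinset_of_orderOf_eq_three (hα : 8 ≤ Fintype.card α)
    (hπ : IsCentralExtension π) (hx : orderOf x = 3)
    (hy : (y : Perm α) ∈ (x : Perm α).cycleFactorsFinset) : DeepCommute π y x := by
  have hthree {c : Perm α} (hc : c ∈ (x : Perm α).cycleFactorsFinset) : c.IsThreeCycle := by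
    have hx' : orderOf (x : Perm α) = 3 := by rw [orderOf_coe, hx]
    rw [← card_support_eq_three_iff, ← hx']
    exact card_support_of_mem_cycleFactorsFinset (hx' ▸ Nat.prime_three) hc
  have hmem : (x : Perm α) ∈ (deepCentralizer π y).map (alternatingGroup α).subtype := by
    refine mem_of_forall_mem_cycleFactorsFinset fun c hc => ?_
    have hc3 := hthree hc
    lift c to alternatingGroup α using hc3.mem_alternatingGroup
    refine mem_map_of_mem _ ((mem_deepCentralizer_iff hπ).2 ?_)
    by_cases hyc : (y : Perm α) = c
    · rw [Subtype.ext hyc]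
      exact refl hπ.ker_le_center c
    · exact of_disjoint_of_card_support_add_le hπ (hthree hy).isCycle
        (cycleFactorsFinset_pairwise_disjoint _ hy hc hyc)
        (by rwa [(hthree hy).card_support, hc3.card_support])
  obtain ⟨z, hz, hzx⟩ := mem_map.1 hmem
  rw [Subtype.ext hzx] at hz
  exact (mem_deepCentralizer_iff hπ).1 hz

theorem DeepCommute.of_mem_cycleFactorsFinset_of_coprime_three (hπ : IsCentralExtension π)
    (hy : (y : Perm α) ∈ (x : Perm α).cycleFactorsFinset)
    (h3 : Nat.Coprime 3 (y : Perm α).support.card) : DeepCommute π y x := by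
  have hrest : DeepCommute π y (x * y⁻¹) := of_disjoint_of_coprime_three hπ
    (mem_cycleFactorsFinset_iff.1 hy).1 (disjoint_mul_inv_of_mem_cycleFactorsFinset hy).symm h3
  simpa using hrest.mul_right hπ (refl hπ.ker_le_center y)

theorem exists_isThreeCycle_deepLinked_of_prime_orderOf (hα : 8 ≤ Fintype.card α)
    (hπ : IsCentralExtension π) (hp : (orderOf x).Prime)
    (hlong : ¬ IsLongPrimeCycle (x : Perm α)) :
    ∃ t : alternatingGroup α, (t : Perm α).IsThreeCycle ∧ DeepLinked π x t := by
  by_cases hp2 : orderOf x = 2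
  · exact exists_isThreeCycle_deepLinked_of_orderOf_eq_two hα hπ hp2
  have hx1 : x ≠ 1 := fun h => hp.ne_one (orderOf_eq_one_iff.2 h)
  have hG := center_alternatingGroup_eq_bot (α := α) (by omega)
  obtain ⟨c, hc⟩ := cycleFactorsFinset_nonempty (mt OneMemClass.coe_eq_one.1 hx1)
  have hcycle := (mem_cycleFactorsFinset_iff.1 hc).1
  have hcard : c.support.card = orderOf x := by
    rw [card_support_of_mem_cycleFactorsFinset (by rwa [orderOf_coe]) hc, orderOf_coe]
  lift c to alternatingGroup α using mem_alternatingGroup.2 <|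
    (sign_eq_one_iff_odd_of_isCycle hcycle).2 (hcard ▸ hp.odd_of_ne_two hp2)
  have hc1 := ne_one_of_isCycle hcycle
  by_cases hp3 : orderOf x = 3
  · exact ⟨c, card_support_eq_three_iff.1 (hcard.trans hp3),
      (DeepCommute.of_mem_cycleFactorsFinset_of_orderOf_eq_three hα hπ hp3 hc).symm.deepLinked
        hπ hG hx1 hc1⟩
  have hcop : Nat.Coprime 3 (orderOf x) := (Nat.coprime_primes Nat.prime_three hp).2 (Ne.symm hp3)
  have hcx := DeepCommute.of_mem_cycleFactorsFinset_of_coprime_three hπ hc (hcard ▸ hcop)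
  have hfix : (c : Perm α).support.card + 3 ≤ Fintype.card α := by
    by_contra! hlt
    have hclong : IsLongPrimeCycle (c : Perm α) := ⟨hcycle, hcard ▸ hp, by omega⟩
    exact hlong <| hclong.of_commute (by omega) (mem_alternatingGroup.1 x.2)
      (mt OneMemClass.coe_eq_one.1 hx1)
      (alternatingGroup_commute_iff.1 (hcx.commute hπ.surjective))
  obtain ⟨t, ht, hct⟩ := exists_isThreeCycle_deepLinked_of_card_support_add_three_le (by omega)
    hπ hc1 (by rw [← orderOf_coe, hcycle.orderOf, hcard]; exact hcop.symm) hfix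
  exact ⟨t, ht, (hcx.symm.deepLinked hπ hG hx1 hc1).trans hct⟩

theorem exists_isThreeCycle_deepLinked (hα : 8 ≤ Fintype.card α) (hπ : IsCentralExtension π)
    (hx : x ≠ 1) (hlong : ¬ IsLongPrimeCycle (x : Perm α)) :
    ∃ t : alternatingGroup α, (t : Perm α).IsThreeCycle ∧ DeepLinked π x t := by
  obtain ⟨p, hp, hdvd⟩ := Nat.exists_prime_and_dvd (mt orderOf_eq_one_iff.1 hx)
  obtain ⟨m, rfl⟩ : ∃ m, orderOf (x ^ m) = p :=
    ⟨_, orderOf_pow_orderOf_div (orderOf_pos x).ne' hdvd⟩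
  have hxm : DeepCommute π x (x ^ m) := by
    simpa using (DeepCommute.refl hπ.ker_le_center x).zpow_right hπ m
  have hxm1 : x ^ m ≠ 1 := fun h => hp.ne_one (orderOf_eq_one_iff.2 h)
  have hlong' : ¬ IsLongPrimeCycle ((x ^ m : alternatingGroup α) : Perm α) := fun h =>
    hlong <| h.of_commute (by omega) (mem_alternatingGroup.1 x.2)
      (mt OneMemClass.coe_eq_one.1 hx) (alternatingGroup_commute_iff.1 (Commute.self_pow x m).symm)
  obtain ⟨t, ht, hlink⟩ := exists_isThreeCycle_deepLinked_of_prime_orderOf hα hπ hp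
    hlong'
  exact ⟨t, ht, (hxm.deepLinked hπ (center_alternatingGroup_eq_bot (by omega)) hx hxm1).trans hlink⟩

theorem deepLinked_iff_longPrimeSubgroup_eq (hα : 8 ≤ Fintype.card α)
    (hπ : IsCentralExtension π) (hx : x ≠ 1) (hy : y ≠ 1) :
    DeepLinked π x y ↔ longPrimeSubgroup (x : Perm α) = longPrimeSubgroup (y : Perm α) := by
  have hG := center_alternatingGroup_eq_bot (α := α) (by omega)
  refine ⟨DeepLinked.eq_of_forall_commute hπ hG fun u v hu hv huv =>
    longPrimeSubgroup_eq_of_commute (by omega) (mem_alternatingGroup.1 u.2)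
      (mem_alternatingGroup.1 v.2) (mt OneMemClass.coe_eq_one.1 hu)
      (mt OneMemClass.coe_eq_one.1 hv) (alternatingGroup_commute_iff.1 huv), fun h => ?_⟩
  by_cases hxl : IsLongPrimeCycle (x : Perm α) <;> by_cases hyl : IsLongPrimeCycle (y : Perm α)
  · rw [longPrimeSubgroup, longPrimeSubgroup, if_pos hxl, if_pos hyl] at h
    obtain ⟨k, hk⟩ := zpowers_le.1 h.ge
    rw [← Subtype.ext (a1 := x ^ k) (a2 := y) hk] at hy ⊢
    exact ((DeepCommute.refl hπ.ker_le_center x).zpow_right hπ k).deepLinked hπ hG hx hy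
  · rw [longPrimeSubgroup, longPrimeSubgroup, if_pos hxl, if_neg hyl, zpowers_eq_bot] at h
    exact absurd h hxl.isCycle.ne_one
  · rw [longPrimeSubgroup, longPrimeSubgroup, if_neg hxl, if_pos hyl, eq_comm, zpowers_eq_bot] at h
    exact absurd h hyl.isCycle.ne_one
  · obtain ⟨s, hs, hxs⟩ := exists_isThreeCycle_deepLinked hα hπ hx hxl
    obtain ⟨t, ht, hyt⟩ := exists_isThreeCycle_deepLinked hα hπ hy hyl
    exact hxs.trans ((deepLinked_of_isThreeCycle hα hπ hs ht).trans hyt.symm)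

theorem natCard_connectedComponent_eq_sum_longPrimes (hα : 8 ≤ Fintype.card α)
    (hπ : IsCentralExtension π) :
    Nat.card (reducedGraph (deepCommutingGraph π)).ConnectedComponent =
      (∑ p ∈ longPrimes (Fintype.card α), (p - 2).factorial * (Fintype.card α).choose p) + 1 := by
  rw [natCard_connectedComponent_reducedGraph_eq_ncard_image hπ
      (center_alternatingGroup_eq_bot (by omega))
      fun _ _ => deepLinked_iff_longPrimeSubgroup_eq hα hπ,
    ncard_image_longPrimeSubgroup_compl_one (by omega)]

end AlternatingGroup

section Count

variable {n : ℕ}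

theorem sum_longPrimes (hn : 2 ≤ n) (f : ℕ → ℕ) :
    ∑ p ∈ longPrimes n, f p = (if n.Prime then f n else 0) +
      (if (n - 1).Prime then f (n - 1) else 0) + if (n - 2).Prime then f (n - 2) else 0 := by
  have hIcc : Finset.Icc (n - 2) n = {n, n - 1, n - 2} := by
    ext k
    simp only [Finset.mem_Icc, Finset.mem_insert, Finset.mem_singleton]
    omega
  rw [longPrimes, Finset.sum_filter, hIcc, Finset.sum_insert, Finset.sum_insert,
    Finset.sum_singleton, add_assoc]
  · rw [Finset.mem_singleton]
    omega
  · rw [Finset.mem_insert, Finset.mem_singleton]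
    omega

theorem factorial_mul_choose_sub_one (hn : 1 ≤ n) :
    (n - 1 - 2).factorial * n.choose (n - 1) = n * (n - 3).factorial := by
  rw [Nat.choose_symm hn, Nat.choose_one_right, mul_comm, Nat.sub_sub]

theorem factorial_mul_choose_sub_two (hn : 2 ≤ n) :
    (n - 2 - 2).factorial * n.choose (n - 2) = n * (n - 1) * (n - 4).factorial / 2 := by
  rw [Nat.choose_symm hn, Nat.choose_two_right, mul_comm, Nat.sub_sub,
    Nat.div_mul_right_comm (Nat.even_mul_pred_self n).two_dvd]

theorem sum_longPrimes_factorial_mul_choose (hn : 2 ≤ n) :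
    ∑ p ∈ longPrimes n, (p - 2).factorial * n.choose p =
      (if n.Prime then (n - 2).factorial else 0) +
        (if (n - 1).Prime then n * (n - 3).factorial else 0) +
        if (n - 2).Prime then n * (n - 1) * (n - 4).factorial / 2 else 0 := by
  rw [sum_longPrimes hn, factorial_mul_choose_sub_one (by omega), factorial_mul_choose_sub_two hn,
    Nat.choose_self, mul_one]

theorem sum_longPrimes_factorial_mul_choose_eq_zero_iff (hn : 2 ≤ n) :
    ∑ p ∈ longPrimes n, (p - 2).factorial * n.choose p = 0 ↔
      ¬ n.Prime ∧ ¬ (n - 1).Prime ∧ ¬ (n - 2).Prime := by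
  have hpos (p : ℕ) (hp : p ≤ n) : (p - 2).factorial * n.choose p ≠ 0 :=
    mul_ne_zero (Nat.factorial_ne_zero _) (Nat.choose_pos hp).ne'
  rw [sum_longPrimes hn]
  simp only [add_eq_zero, ite_eq_right_iff, hpos n le_rfl, hpos (n - 1) (Nat.sub_le n 1),
    hpos (n - 2) (Nat.sub_le n 2), imp_false, and_assoc]

theorem not_prime_sub_one_of_prime (hn : 4 ≤ n) (h : n.Prime) : ¬ (n - 1).Prime := by
  intro h'
  have hodd := h.odd_of_ne_two (by omega)
  have hodd' := h'.odd_of_ne_two (by omega)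
  rw [Nat.odd_iff] at hodd hodd'
  omega

end Count

theorem mainTheorem12_general {α : Type*} [Fintype α] [DecidableEq α] {n : ℕ} (hn : 8 ≤ n)
    (hα : Fintype.card α = n) {E : Type*} [Group E] {π : E →* alternatingGroup α}
    (hπ : IsCentralExtension π) :
    ((reducedGraph (deepCommutingGraph π)).Connected ↔
        ¬ n.Prime ∧ ¬ (n - 1).Prime ∧ ¬ (n - 2).Prime) ∧
    (n.Prime ∧ ¬ (n - 1).Prime ∧ ¬ (n - 2).Prime →
      Nat.card (reducedGraph (deepCommutingGraph π)).ConnectedComponent =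
        Nat.factorial (n - 2) + 1) ∧
    (¬ n.Prime ∧ (n - 1).Prime ∧ ¬ (n - 2).Prime →
      Nat.card (reducedGraph (deepCommutingGraph π)).ConnectedComponent =
        n * Nat.factorial (n - 3) + 1) ∧
    (¬ n.Prime ∧ ¬ (n - 1).Prime ∧ (n - 2).Prime →
      Nat.card (reducedGraph (deepCommutingGraph π)).ConnectedComponent =
        n * (n - 1) * Nat.factorial (n - 4) / 2 + 1) ∧
    (n.Prime ∧ (n - 2).Prime →
      Nat.card (reducedGraph (deepCommutingGraph π)).ConnectedComponent =
        Nat.factorial (n - 2) + n * (n - 1) * Nat.factorial (n - 4) / 2 + 1) := by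
  have hsum := natCard_connectedComponent_eq_sum_longPrimes (hα ▸ hn) hπ
  rw [hα] at hsum
  have hcard := hsum.trans (congrArg (· + 1) (sum_longPrimes_factorial_mul_choose (by omega)))
  refine ⟨?_, fun ⟨h0, h1, h2⟩ => ?_, fun ⟨h0, h1, h2⟩ => ?_, fun ⟨h0, h1, h2⟩ => ?_,
    fun ⟨h0, h2⟩ => ?_⟩
  · rw [connected_iff_natCard_connectedComponent_eq_one, hsum, Nat.add_eq_right,
      sum_longPrimes_factorial_mul_choose_eq_zero_iff (by omega)]
  · rw [hcard, if_pos h0, if_neg h1, if_neg h2, add_zero, add_zero]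
  · rw [hcard, if_neg h0, if_pos h1, if_neg h2, zero_add, add_zero]
  · rw [hcard, if_neg h0, if_neg h1, if_pos h2, zero_add, zero_add]
  · rw [hcard, if_pos h0, if_neg (not_prime_sub_one_of_prime (by omega) h0), if_pos h2, add_zero]

theorem mainTheorem12 (n : ℕ) (hn : 8 ≤ n) {E : Type*} [Group E]
    (π : E →* alternatingGroup (Fin n)) (hπ : IsSchurCover π) :
    ((reducedGraph (deepCommutingGraph π)).Connected ↔
        ¬ n.Prime ∧ ¬ (n - 1).Prime ∧ ¬ (n - 2).Prime) ∧
    (n.Prime ∧ ¬ (n - 1).Prime ∧ ¬ (n - 2).Prime →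
      Nat.card (reducedGraph (deepCommutingGraph π)).ConnectedComponent = Nat.factorial (n - 2) + 1) ∧
    (¬ n.Prime ∧ (n - 1).Prime ∧ ¬ (n - 2).Prime →
      Nat.card (reducedGraph (deepCommutingGraph π)).ConnectedComponent = n * Nat.factorial (n - 3) + 1) ∧
    (¬ n.Prime ∧ ¬ (n - 1).Prime ∧ (n - 2).Prime →
      Nat.card (reducedGraph (deepCommutingGraph π)).ConnectedComponent =
        n * (n - 1) * Nat.factorial (n - 4) / 2 + 1) ∧
    (n.Prime ∧ (n - 2).Prime →
      Nat.card (reducedGraph (deepCommutingGraph π)).ConnectedComponent =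
        Nat.factorial (n - 2) + n * (n - 1) * Nat.factorial (n - 4) / 2 + 1) :=
  mainTheorem12_general hn (Fintype.card_fin n) hπ.isStem.isCentralExtension
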